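/- Let $X$ be a (almost surely) non-negative real random variable with probability density function $f:\mathbb R\to[0,\infty)$. Assume that $f$ is analytic on $[0,\infty)$, i.e. for every $x\ge 0$ there is a power series centred at $x$, with positive radius of convergence, whose sum equals $f(y)$ for all $y\ge 0$ close enough to $x$; and assume that $f(0)>0$. Let $n$ and $s$ be fixed integers with $1\le s\le n-1$, let $X_1,\dots,X_n$ be independent random variables each distributed as $X$, and write $X_{m:m}=\max(X_1,\dots,X_m)$ for $1\le m\le n$. If $$X_{n-s:n-s}+\frac{1}{n-s+1}X_{n-s+1}+\frac{1}{n-s+2}X_{n-s+2}+\cdots+\frac1n X_n\ \stackrel{d}{=}\ X_{n:n},$$ where $\stackrel{d}{=}$ denotes equality in distribution, then $X$ is exponentially distributed with some parameter $\lambda>0$, i.e. $P(X\le x)=1-e^{-\lambda x}$ for all $x\ge 0$. -/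

import Mathlib

open MeasureTheory ProbabilityTheory

/-- The maximum order statistic `X_{m:m} = max (X_1, …, X_m)` of the first `m` members of the
family `X_1, X_2, …`. It is the genuine maximum for every `m ≥ 1`, see
`maxOrderStat_isGreatest`. -/
noncomputable def maxOrderStat {Ω : Type*} (X : ℕ → Ω → ℝ) (m : ℕ) (ω : Ω) : ℝ :=
  ⨆ i : Finset.Icc 1 m, X i ω

theorem maxOrderStat_isGreatest {Ω : Type*} (X : ℕ → Ω → ℝ) {m : ℕ} (hm : 1 ≤ m) (ω : Ω) :
    IsGreatest ((fun i => X i ω) '' Set.Icc 1 m) (maxOrderStat X m ω) := by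
  have : Nonempty (Finset.Icc 1 m) := ⟨⟨1, by simp [hm]⟩⟩
  constructor
  · obtain ⟨i, hi⟩ := exists_eq_ciSup_of_finite (f := fun i : Finset.Icc 1 m => X i ω)
    exact ⟨i, Finset.mem_Icc.1 i.2, hi⟩
  · rintro _ ⟨i, hi, rfl⟩
    exact le_ciSup (f := fun i : Finset.Icc 1 m => X i ω) (Set.finite_range _).bddAbove
      ⟨i, by simpa using hi⟩

/-!
Let `F` be the distribution function of `X`. Adding an independent `X / k` to a non-negative
variable replaces its distribution function `A` by `scaledConv f k A` (`measureReal_add_mul_le`).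
The hypothesis therefore says that iterating `scaledConv f k` for `k = m + 1, …, n`, where `m = n - s`, turns `F ^ m` into `F ^ n`.

Every density `f₀ x = lam * exp (κ x)`, whatever the sign of `κ`, satisfies the stepwise identity
`scaledConv f₀ k (F₀ ^ (k - 1)) = F₀ ^ k` with `F₀ x = ∫₀ˣ f₀` (`scaledConv_exp`). This is why the
value and the slope of `f` at the origin are both left free by the local equation. Choose `lam` and
`κ` so that `f₀` has the value and the slope of `f` at `0`. If `f` and `f₀` differ near `0`, then
`f x - f₀ x ~ c x ^ r` with `r ≥ 2` and `c ≠ 0`, and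

  `scaledConv f k (F ^ (k - 1)) x - F x ^ k ~ C c x ^ (k + r)`,

where `C > 0` because `(k + r - 1)! < k ^ r (k - 1)! r!` for `k, r ≥ 2`
(`exists_tendsto_scaledConv_sub_pow`). All these errors have the sign of `c` near `0`, and
`scaledConv f k` is monotone in its argument since `f ≥ 0`, so they cannot cancel: the final
distribution function is not `F ^ n` (`eq_zero_of_iterated_scaledConv_eq_pow`).

Hence `f = f₀` near `0`, and on all of `(0, ∞)` by the identity theorem
(`exists_eq_mul_exp_of_analyticOn`). Only the total mass of `f` forces `κ < 0` and `lam = -κ`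
(`withDensity_eq_expMeasure`).
-/

open Filter Topology Set

/-! ### Convolution asymptotics at the origin -/

theorem integral_one_sub_pow_mul_pow (p q : ℕ) :
    ∫ t in (0 : ℝ)..1, (1 - t) ^ p * t ^ q = p.factorial * q.factorial / (p + q + 1).factorial := by
  -- Integration by parts lowers `p` and raises `q`.
  induction p generalizing q with
  | zero =>
    have : ((q + 1).factorial : ℝ) = (q + 1) * q.factorial := by
      rw [Nat.factorial_succ]; push_cast; ring
    have h0 : (q.factorial : ℝ) ≠ 0 := by positivity
    simp only [pow_zero, one_mul, integral_pow, zero_add, this]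
    field_simp
    simp
  | succ p ih =>
    have hparts : ∫ t in (0 : ℝ)..1, ((q + 1 : ℝ) * ((1 - t) ^ (p + 1) * t ^ q)
        - (p + 1 : ℝ) * ((1 - t) ^ p * t ^ (q + 1))) = 0 := by
      rw [intervalIntegral.integral_eq_sub_of_hasDerivAt
        (f := fun t : ℝ => (1 - t) ^ (p + 1) * t ^ (q + 1))]
      · simp
      · intro t _
        convert! (((hasDerivAt_id t).const_sub 1).pow (p + 1)).mul
          ((hasDerivAt_id t).pow (q + 1)) using 1
        simp
        ring
      · exact Continuous.intervalIntegrable (by fun_prop) _ _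
    rw [intervalIntegral.integral_sub (Continuous.intervalIntegrable (by fun_prop) _ _)
      (Continuous.intervalIntegrable (by fun_prop) _ _), intervalIntegral.integral_const_mul,
      intervalIntegral.integral_const_mul, ih (q + 1)] at hparts
    have h1 : ((q + 1).factorial : ℝ) = (q + 1) * q.factorial := by
      rw [Nat.factorial_succ]; push_cast; ring
    have h2 : ((p + 1).factorial : ℝ) = (p + 1) * p.factorial := by
      rw [Nat.factorial_succ]; push_cast; ring
    have h3 : p + 1 + q + 1 = p + (q + 1) + 1 := by ring
    rw [h1] at hparts
    rw [h2, h3]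
    have hq : (q + 1 : ℝ) ≠ 0 := by positivity
    apply mul_left_cancel₀ hq
    rw [sub_eq_zero.1 hparts]
    ring

/-- The distribution function at `x` of `Z + W / k`, where `Z ≥ 0` has distribution function `A`
and `W ≥ 0` is independent of `Z` with density `f`. The variable of integration is rescaled to
`[0, 1]`. -/
noncomputable def scaledConv (f : ℝ → ℝ) (k : ℝ) (A : ℝ → ℝ) (x : ℝ) : ℝ :=
  k * x * ∫ t in (0 : ℝ)..1, A (x * (1 - t)) * f (k * x * t)

theorem continuousOn_comp_mul_one_sub {A : ℝ → ℝ} (hA : ContinuousOn A (Ici 0)) {x : ℝ}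
    (hx : 0 ≤ x) : ContinuousOn (fun t => A (x * (1 - t))) (uIcc 0 1) := by
  refine hA.comp (by fun_prop) fun t ht => ?_
  rw [uIcc_of_le zero_le_one] at ht
  exact mul_nonneg hx (by linarith [ht.2])

theorem continuousOn_comp_mul {g : ℝ → ℝ} (hg : ContinuousOn g (Ici 0)) {x : ℝ}
    (hx : 0 ≤ x) : ContinuousOn (fun t => g (x * t)) (uIcc 0 1) := by
  refine hg.comp (by fun_prop) fun t ht => ?_
  rw [uIcc_of_le zero_le_one] at ht
  exact mul_nonneg hx ht.1

/-- If `A y ~ a y ^ p` and `g y ~ b y ^ q` at `0+`, then their (rescaled) convolution is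
asymptotic to the convolution of the two monomials. -/
theorem tendsto_integral_mul_div_pow {A g : ℝ → ℝ} (hA : ContinuousOn A (Ici 0))
    (hg : ContinuousOn g (Ici 0)) {p q : ℕ} {a b k : ℝ} (hk : 0 < k)
    (hAa : Tendsto (fun x => A x / x ^ p) (𝓝[>] 0) (𝓝 a))
    (hgb : Tendsto (fun x => g x / x ^ q) (𝓝[>] 0) (𝓝 b)) :
    Tendsto (fun x => (∫ t in (0 : ℝ)..1, A (x * (1 - t)) * g (k * x * t)) / x ^ (p + q)) (𝓝[>] 0)
      (𝓝 (a * b * k ^ q * (p.factorial * q.factorial / (p + q + 1).factorial))) := by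
  -- The integrand in terms of the two quotients.
  let φ : ℝ → ℝ → ℝ := fun x t => (A (x * (1 - t)) / (x * (1 - t)) ^ p) *
    (g (k * x * t) / (k * x * t) ^ q) * (k ^ q * ((1 - t) ^ p * t ^ q))
  have hφ : ∀ x t : ℝ, 0 < x → 0 < t → t < 1 →
      A (x * (1 - t)) * g (k * x * t) / x ^ (p + q) = φ x t := by
    intro x t hx ht ht1
    have : 0 < 1 - t := by linarith
    simp only [φ, mul_pow, pow_add]
    field_simp
  have hne : ∀ᵐ t : ℝ, t ≠ 1 := by simp [ae_iff]
  have hlim : Tendsto (fun x => ∫ t in (0 : ℝ)..1,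
      A (x * (1 - t)) * g (k * x * t) / x ^ (p + q)) (𝓝[>] 0)
      (𝓝 (∫ t in (0 : ℝ)..1, a * b * (k ^ q * ((1 - t) ^ p * t ^ q)))) := by
    have hA' : ∀ᶠ y in 𝓝[>] (0 : ℝ), |A y / y ^ p| ≤ |a| + 1 :=
      (hAa.abs.eventually_le_const (lt_add_one _))
    have hg' : ∀ᶠ y in 𝓝[>] (0 : ℝ), |g y / y ^ q| ≤ |b| + 1 :=
      (hgb.abs.eventually_le_const (lt_add_one _))
    obtain ⟨δ, hδ, hδ'⟩ := (mem_nhdsGT_iff_exists_Ioo_subset).1 (hA'.and hg')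
    have hδ : 0 < δ := hδ
    have hsmall : ∀ᶠ x in 𝓝[>] (0 : ℝ), 0 < x ∧ x < δ ∧ k * x < δ := by
      have h1 : ∀ᶠ x in 𝓝[>] (0 : ℝ), x < δ := mem_nhdsWithin_of_mem_nhds (Iio_mem_nhds hδ)
      have h2 : ∀ᶠ x in 𝓝[>] (0 : ℝ), x < δ / k :=
        mem_nhdsWithin_of_mem_nhds (Iio_mem_nhds (div_pos hδ hk))
      filter_upwards [h1, h2, self_mem_nhdsWithin] with x h1 h2 h3
      exact ⟨h3, h1, by rwa [lt_div_iff₀' hk] at h2⟩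
    refine intervalIntegral.tendsto_integral_filter_of_dominated_convergence
      (fun _ => (|a| + 1) * (|b| + 1) * k ^ q) ?_ ?_ ?_ ?_
    · filter_upwards [hsmall] with x hx
      rw [uIoc_of_le zero_le_one]
      have : ContinuousOn (fun t => A (x * (1 - t)) * g (k * x * t) / x ^ (p + q)) (uIcc 0 1) :=
        ((continuousOn_comp_mul_one_sub hA hx.1.le).mul
          (continuousOn_comp_mul hg (mul_pos hk hx.1).le)).div_const _
      rw [uIcc_of_le zero_le_one] at this
      exact (this.mono Ioc_subset_Icc_self).aestronglyMeasurable measurableSet_Ioc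
    · filter_upwards [hsmall] with x hx
      filter_upwards [hne] with t ht1 ht
      rw [uIoc_of_le zero_le_one] at ht
      have ht1 : t < 1 := lt_of_le_of_ne ht.2 ht1
      have h1t : 0 < 1 - t := by linarith
      rw [hφ x t hx.1 ht.1 ht1, Real.norm_eq_abs]
      have e1 := (hδ' (show x * (1 - t) ∈ Ioo 0 δ from
        ⟨mul_pos hx.1 h1t, by nlinarith [hx.1, hx.2.1, ht.1]⟩)).1
      have e2 := (hδ' (show k * x * t ∈ Ioo 0 δ from
        ⟨mul_pos (mul_pos hk hx.1) ht.1, by nlinarith [mul_pos hk hx.1, hx.2.2, ht.1]⟩)).2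
      simp only [φ, abs_mul]
      have e3 : |k ^ q| = k ^ q := abs_of_nonneg (by positivity)
      have e4 : |(1 - t) ^ p| ≤ 1 := by
        rw [abs_of_nonneg (by positivity)]
        exact pow_le_one₀ h1t.le (by linarith [ht.1])
      have e5 : |t ^ q| ≤ 1 := by
        rw [abs_of_nonneg (pow_nonneg ht.1.le _)]
        exact pow_le_one₀ ht.1.le ht.2
      rw [e3]
      have e6 : |(1 - t) ^ p| * |t ^ q| ≤ 1 := mul_le_one₀ e4 (abs_nonneg _) e5
      have e7 : k ^ q * (|(1 - t) ^ p| * |t ^ q|) ≤ k ^ q :=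
        mul_le_of_le_one_right (by positivity) e6
      have e8 := mul_le_mul e1 e2 (abs_nonneg _) (by positivity)
      exact mul_le_mul e8 e7 (by positivity) (by positivity)
    · exact intervalIntegrable_const
    · filter_upwards [hne] with t ht1 ht
      rw [uIoc_of_le zero_le_one] at ht
      have ht1 : t < 1 := lt_of_le_of_ne ht.2 ht1
      have h1t : 0 < 1 - t := by linarith
      have s1 : Tendsto (fun x : ℝ => x * (1 - t)) (𝓝[>] 0) (𝓝[>] 0) := by
        refine tendsto_nhdsWithin_iff.2 ⟨?_, ?_⟩
        · exact Tendsto.mono_left (Continuous.tendsto' (by fun_prop) _ _ (by simp))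
            nhdsWithin_le_nhds
        · filter_upwards [self_mem_nhdsWithin] with x hx using mul_pos hx h1t
      have s2 : Tendsto (fun x : ℝ => k * x * t) (𝓝[>] 0) (𝓝[>] 0) := by
        refine tendsto_nhdsWithin_iff.2 ⟨?_, ?_⟩
        · exact Tendsto.mono_left (Continuous.tendsto' (by fun_prop) _ _ (by simp))
            nhdsWithin_le_nhds
        · filter_upwards [self_mem_nhdsWithin] with x hx using mul_pos (mul_pos hk hx) ht.1
      refine Tendsto.congr' ?_ (((hAa.comp s1).mul (hgb.comp s2)).mul_const _)
      filter_upwards [self_mem_nhdsWithin] with x hx using (hφ x t hx ht.1 ht1).symm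
  simp only [intervalIntegral.integral_div, intervalIntegral.integral_const_mul,
    integral_one_sub_pow_mul_pow] at hlim
  simpa only [mul_assoc] using hlim

/-- The leading term of `F ^ (j + 1) - G ^ (j + 1)` at `0+`, from that of `F - G` and a common
first-order term `lam * x`. -/
theorem tendsto_pow_sub_pow_div_pow {F G : ℝ → ℝ} {lam d : ℝ} {r : ℕ}
    (hF : Tendsto (fun x => F x / x) (𝓝[>] 0) (𝓝 lam))
    (hG : Tendsto (fun x => G x / x) (𝓝[>] 0) (𝓝 lam))
    (hFG : Tendsto (fun x => (F x - G x) / x ^ (r + 1)) (𝓝[>] 0) (𝓝 d)) (j : ℕ) :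
    Tendsto (fun x => (F x ^ (j + 1) - G x ^ (j + 1)) / x ^ (j + 1 + r)) (𝓝[>] 0)
      (𝓝 ((j + 1) * lam ^ j * d)) := by
  induction j with
  | zero => simpa [add_comm] using hFG
  | succ j ih =>
    have := (hF.mul ih).add ((hG.pow (j + 1)).mul hFG)
    have e : lam * ((j + 1) * lam ^ j * d) + lam ^ (j + 1) * d
        = ((j + 1 : ℕ) + 1) * lam ^ (j + 1) * d := by push_cast; ring
    rw [e] at this
    refine this.congr' ?_
    filter_upwards [self_mem_nhdsWithin] with x hx
    have hx : x ≠ 0 := ne_of_gt hx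
    have hxj : x ^ (j + 1) ≠ 0 := pow_ne_zero _ hx
    rw [show j + 1 + 1 + r = (j + 1) + (r + 1) by ring, pow_add x (j + 1) (r + 1),
      pow_add x (j + 1) r, pow_succ x r, div_pow, pow_succ (F x) (j + 1), pow_succ (G x) (j + 1)]
    field_simp
    ring

theorem continuousOn_integral_Ici {f : ℝ → ℝ} (hf : ContinuousOn f (Ici 0)) :
    ContinuousOn (fun x => ∫ u in (0 : ℝ)..x, f u) (Ici 0) := by
  intro x hx
  have hx : 0 ≤ x := hx
  have h1 : ContinuousOn (fun x => ∫ u in (0 : ℝ)..x, f u) (uIcc 0 (x + 1)) := by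
    refine intervalIntegral.continuousOn_primitive_interval ?_
    rw [uIcc_of_le (by linarith)]
    exact (hf.mono Icc_subset_Ici_self).integrableOn_Icc
  rw [uIcc_of_le (by linarith)] at h1
  refine (h1 x ⟨hx, by linarith⟩).mono_of_mem_nhdsWithin ?_
  rw [← Ici_inter_Iic]
  exact inter_mem self_mem_nhdsWithin
    (mem_nhdsWithin_of_mem_nhds (Iic_mem_nhds (by linarith)))

theorem tendsto_integral_div_pow {g : ℝ → ℝ} (hg : ContinuousOn g (Ici 0)) {q : ℕ} {b : ℝ}
    (hgb : Tendsto (fun x => g x / x ^ q) (𝓝[>] 0) (𝓝 b)) :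
    Tendsto (fun x => (∫ u in (0 : ℝ)..x, g u) / x ^ (q + 1)) (𝓝[>] 0) (𝓝 (b / (q + 1))) := by
  have := tendsto_integral_mul_div_pow (A := fun _ => 1) (p := 0) (a := 1) (k := 1)
    continuousOn_const hg one_pos (by simp) hgb
  have e : 1 * b * 1 ^ q * ((Nat.factorial 0 : ℝ) * q.factorial / (0 + q + 1).factorial)
      = b / (q + 1) := by
    have h0 : (q.factorial : ℝ) ≠ 0 := by positivity
    rw [zero_add, Nat.factorial_succ]
    push_cast
    simp only [Nat.factorial_zero, Nat.cast_one, one_pow, one_mul, mul_one]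
    field_simp
  rw [e] at this
  refine this.congr' ?_
  filter_upwards [self_mem_nhdsWithin] with x hx
  have hx : x ≠ 0 := ne_of_gt hx
  have h1 := intervalIntegral.mul_integral_comp_mul_left (a := 0) (b := 1) (f := g) x
  rw [mul_zero, mul_one] at h1
  rw [← h1]
  simp only [one_mul, zero_add]
  rw [pow_succ]
  field_simp

/-! ### The convolution step near an exponential density -/

/-- For the exponential density `lam * exp (κ y)`, with `κ` of any sign, the convolution with the
density scaled by `1 / k` raises the power of the distribution function from `k - 1` to `k`. -/
theorem scaledConv_exp (lam κ : ℝ) (j : ℕ) (x : ℝ) :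
    scaledConv (fun y => lam * Real.exp (κ * y)) (j + 1)
      (fun y => (∫ u in (0 : ℝ)..y, lam * Real.exp (κ * u)) ^ j) x =
      (∫ u in (0 : ℝ)..x, lam * Real.exp (κ * u)) ^ (j + 1) := by
  set G : ℝ → ℝ := fun y => ∫ u in (0 : ℝ)..y, lam * Real.exp (κ * u) with hG
  have hcont : Continuous fun u => lam * Real.exp (κ * u) := by fun_prop
  have hGd : ∀ y, HasDerivAt G (lam * Real.exp (κ * y)) y := fun y =>
    intervalIntegral.integral_hasDerivAt_right (hcont.intervalIntegrable _ _)
      (hcont.stronglyMeasurableAtFilter _ _) hcont.continuousAt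
  have hshift : ∀ y z, G (y + z) - G y = Real.exp (κ * y) * G z := by
    intro y z
    simp only [hG]
    rw [intervalIntegral.integral_interval_sub_left (hcont.intervalIntegrable _ _)
      (hcont.intervalIntegrable _ _), ← intervalIntegral.integral_const_mul]
    have := intervalIntegral.integral_comp_add_right (a := 0) (b := z)
      (fun u => lam * Real.exp (κ * u)) y
    rw [zero_add, add_comm z y] at this
    rw [← this]
    congr 1 with u
    rw [mul_add, Real.exp_add]
    ring
  have hGc : Continuous G := continuous_iff_continuousAt.2 fun y => (hGd y).continuousAt
  have hftc : ∫ t in (0 : ℝ)..1, (j + 1) * (G x - G (x * t)) ^ j *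
      (lam * Real.exp (κ * (x * t)) * x) = G x ^ (j + 1) := by
    rw [intervalIntegral.integral_eq_sub_of_hasDerivAt
      (f := fun t : ℝ => -(G x - G (x * t)) ^ (j + 1))]
    · simp [hG]
    · intro t _
      have h1 : HasDerivAt (fun t : ℝ => x * t) x t := by
        simpa using (hasDerivAt_id t).const_mul x
      convert! ((((hGd (x * t)).comp t h1).const_sub (G x)).pow (j + 1)).neg using 1
      simp
    · exact Continuous.intervalIntegrable (by fun_prop) _ _
  rw [← hftc, scaledConv, ← intervalIntegral.integral_const_mul]
  congr 1 with t
  have h2 : G x - G (x * t) = Real.exp (κ * (x * t)) * G (x * (1 - t)) := by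
    rw [← hshift]; ring_nf
  rw [h2, mul_pow, ← Real.exp_nat_mul]
  have h3 : Real.exp (κ * ((j + 1) * x * t)) =
      Real.exp (j * (κ * (x * t))) * Real.exp (κ * (x * t)) := by
    rw [← Real.exp_add]; ring_nf
  rw [h3]
  ring

/-- The inequality behind the sign of the error coefficient, with `k = i + 2`. It is an equality for
`r = 1`, which is why the slope of `f` at the origin is not determined. -/
theorem factorial_add_lt_pow_mul {i r : ℕ} (hr : 2 ≤ r) :
    (i + 1 + r).factorial < (i + 2) ^ r * ((i + 1).factorial * r.factorial) := by
  induction r, hr using Nat.le_induction with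
  | base =>
    rw [show i + 1 + 2 = (i + 1 + 1) + 1 by ring, Nat.factorial_succ, Nat.factorial_succ (i + 1)]
    have := Nat.factorial_pos (i + 1)
    simp only [Nat.factorial_two]
    have h : (i + 1 + 1 + 1) * (i + 1 + 1) < (i + 2) ^ 2 * 2 := by nlinarith
    nlinarith [Nat.mul_lt_mul_of_pos_right h this]
  | succ r _ ih =>
    rw [show i + 1 + (r + 1) = (i + 1 + r) + 1 by ring, Nat.factorial_succ, Nat.factorial_succ r]
    calc (i + 1 + r + 1) * (i + 1 + r).factorial
        < (i + 1 + r + 1) * ((i + 2) ^ r * ((i + 1).factorial * r.factorial)) := by gcongr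
      _ ≤ ((i + 2) * (r + 1)) * ((i + 2) ^ r * ((i + 1).factorial * r.factorial)) := by
          gcongr; nlinarith
      _ = _ := by ring

/-- If `f` first deviates from `lam * exp (κ y)` by a term `c y ^ r` with `r ≥ 2`, then convolving
`F ^ (k - 1)` with the density of `X / k` (here `k = i + 2`) misses `F ^ k` by a term of order
`k + r` whose coefficient has the sign of `c`. -/
theorem exists_tendsto_scaledConv_sub_pow {f : ℝ → ℝ} (hf : ContinuousOn f (Ici 0))
    {lam κ c : ℝ} {r : ℕ} (hlam : 0 < lam) (hr : 2 ≤ r)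
    (hc : Tendsto (fun x => (f x - lam * Real.exp (κ * x)) / x ^ r) (𝓝[>] 0) (𝓝 c)) (i : ℕ) :
    ∃ C : ℝ, 0 < C ∧ Tendsto (fun x =>
      (scaledConv f ((i + 1 : ℕ) + 1) (fun y => (∫ u in (0 : ℝ)..y, f u) ^ (i + 1)) x
        - (∫ u in (0 : ℝ)..x, f u) ^ (i + 2)) / x ^ (i + 2 + r)) (𝓝[>] 0) (𝓝 (C * c)) := by
  set g : ℝ → ℝ := fun y => lam * Real.exp (κ * y) with hg
  have hgc : Continuous g := by fun_prop
  set F : ℝ → ℝ := fun x => ∫ u in (0 : ℝ)..x, f u with hF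
  set G : ℝ → ℝ := fun x => ∫ u in (0 : ℝ)..x, g u with hG
  have hFc : ContinuousOn F (Ici 0) := continuousOn_integral_Ici hf
  have hGc : ContinuousOn G (Ici 0) := continuousOn_integral_Ici hgc.continuousOn
  have hg0 : Tendsto g (𝓝[>] 0) (𝓝 lam) :=
    Tendsto.mono_left (hgc.tendsto' _ _ (by simp [hg])) nhdsWithin_le_nhds
  have hf0 : Tendsto f (𝓝[>] 0) (𝓝 lam) := by
    have h1 : Tendsto (fun x : ℝ => x ^ r) (𝓝[>] 0) (𝓝 0) :=
      Tendsto.mono_left (Continuous.tendsto' (by fun_prop) _ _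
        (by simp [show r ≠ 0 by omega])) nhdsWithin_le_nhds
    have h2 := (hc.mul h1).add hg0
    rw [mul_zero, zero_add] at h2
    refine h2.congr' ?_
    filter_upwards [self_mem_nhdsWithin] with x hx
    have hx : x ≠ 0 := ne_of_gt hx
    simp only [hg]
    field_simp
    ring
  have hFx : Tendsto (fun x => F x / x) (𝓝[>] 0) (𝓝 lam) := by
    simpa using tendsto_integral_div_pow (q := 0) hf (by simpa using hf0)
  have hGx : Tendsto (fun x => G x / x) (𝓝[>] 0) (𝓝 lam) := by
    simpa using tendsto_integral_div_pow (q := 0) hgc.continuousOn (by simpa using hg0)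
  have hfg : ContinuousOn (fun y => f y - g y) (Ici 0) := hf.sub hgc.continuousOn
  have hFGx : Tendsto (fun x => (F x - G x) / x ^ (r + 1)) (𝓝[>] 0) (𝓝 (c / (r + 1))) := by
    refine (tendsto_integral_div_pow hfg hc).congr' ?_
    filter_upwards [self_mem_nhdsWithin] with x hx
    have hx : 0 < x := hx
    rw [intervalIntegral.integral_sub _ (hgc.intervalIntegrable _ _)]
    refine (hf.mono ?_).intervalIntegrable
    rw [uIcc_of_le hx.le]
    exact Icc_subset_Ici_self
  have hpow := tendsto_pow_sub_pow_div_pow hFx hGx hFGx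
  have hk : (0 : ℝ) < (i + 1 : ℕ) + 1 := by positivity
  set k : ℝ := (i + 1 : ℕ) + 1 with hkdef
  have hFp : ContinuousOn (fun y => F y ^ (i + 1)) (Ici 0) := hFc.pow _
  have hGp : ContinuousOn (fun y => G y ^ (i + 1)) (Ici 0) := hGc.pow _
  have hDc : ContinuousOn (fun y => F y ^ (i + 1) - G y ^ (i + 1)) (Ici 0) :=
    hFp.sub hGp
  have t1 := (tendsto_integral_mul_div_pow hDc hf (q := 0) hk (hpow i)
    (by simpa using hf0)).const_mul k
  have t2 := (tendsto_integral_mul_div_pow hGp hfg (p := i + 1) hk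
    (by simpa only [← div_pow] using hGx.pow (i + 1)) hc).const_mul k
  have t3 := hpow (i + 1)
  -- The three contributions to the coefficient: changing the distribution function in the
  -- convolution, changing the density, and changing the `k`-th power.
  refine ⟨lam ^ (i + 1) * k / (k + r) *
    (k ^ r * ((i + 1).factorial * r.factorial) / (i + 1 + r).factorial - 1), ?_, ?_⟩
  · have h1 : ((i + 1 + r).factorial : ℝ) < k ^ r * ((i + 1).factorial * r.factorial) := by
      have := factorial_add_lt_pow_mul (i := i) hr
      rw [hkdef]
      have h2 : (((i + 1 : ℕ) : ℝ) + 1) = ((i + 2 : ℕ) : ℝ) := by push_cast; ring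
      rw [h2]
      exact_mod_cast this
    have h3 : (0 : ℝ) < (i + 1 + r).factorial := by positivity
    have : 1 < k ^ r * ((i + 1).factorial * r.factorial) / (i + 1 + r).factorial := by
      rwa [one_lt_div h3]
    have : 0 < k ^ r * ((i + 1).factorial * r.factorial) / (i + 1 + r).factorial - 1 := by linarith
    positivity
  · have tt := (t1.add t2).sub t3
    have hval : lam ^ (i + 1) * k / (k + r) *
        (k ^ r * ((i + 1).factorial * r.factorial) / (i + 1 + r).factorial - 1) * c =
        k * ((↑i + 1) * lam ^ i * (c / (↑r + 1)) * lam * k ^ 0 *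
          (↑(i + 1 + r).factorial * ↑(Nat.factorial 0) / ↑(i + 1 + r + 0 + 1).factorial)) +
        k * (lam ^ (i + 1) * c * k ^ r *
          (↑(i + 1).factorial * ↑r.factorial / ↑(i + 1 + r + 1).factorial)) -
        (↑(i + 1) + 1) * lam ^ (i + 1) * (c / (↑r + 1)) := by
      rw [add_zero, Nat.factorial_succ (i + 1 + r), pow_zero, Nat.factorial_zero, ← hkdef]
      have h3 : ((i + 1 + r).factorial : ℝ) ≠ 0 := by positivity
      have h4 : (((i + 1 + r + 1 : ℕ)) : ℝ) = k + r := by rw [hkdef]; push_cast; ring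
      have h5 : (i : ℝ) + 1 = k - 1 := by rw [hkdef]; push_cast; ring
      have h6 : k + r ≠ 0 := by positivity
      have h7 : (r + 1 : ℝ) ≠ 0 := by positivity
      rw [Nat.cast_mul, h4, h5, Nat.cast_one, pow_succ]
      field_simp
      ring
    rw [hval]
    refine tt.congr' ?_
    filter_upwards [self_mem_nhdsWithin] with x hx
    have hx : 0 < x := hx
    have hx0 : x ≠ 0 := hx.ne'
    have hkx : 0 ≤ k * x := by positivity
    have c1 := continuousOn_comp_mul_one_sub hFp hx.le
    have c2 := continuousOn_comp_mul_one_sub hGp hx.le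
    have c3 := continuousOn_comp_mul hf hkx
    have c4 := continuousOn_comp_mul hgc.continuousOn hkx
    have hsplit : scaledConv f k (fun y => F y ^ (i + 1)) x =
        k * x * (∫ t in (0 : ℝ)..1, (F (x * (1 - t)) ^ (i + 1) - G (x * (1 - t)) ^ (i + 1)) *
          f (k * x * t)) +
        k * x * (∫ t in (0 : ℝ)..1, G (x * (1 - t)) ^ (i + 1) *
          (f (k * x * t) - g (k * x * t))) + G x ^ (i + 2) := by
      have hex : scaledConv g k (fun y => G y ^ (i + 1)) x = G x ^ (i + 2) :=
        scaledConv_exp lam κ (i + 1) x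
      rw [← hex]
      unfold scaledConv
      rw [← mul_add, ← mul_add, ← intervalIntegral.integral_add, ← intervalIntegral.integral_add]
      · congr 2 with t
        ring
      · exact (((c1.sub c2).mul c3).add (c2.mul (c3.sub c4))).intervalIntegrable
      · exact (c2.mul c4).intervalIntegrable
      · exact ((c1.sub c2).mul c3).intervalIntegrable
      · exact (c2.mul (c3.sub c4)).intervalIntegrable
    rw [hsplit, show i + 2 + r = (i + 1 + r) + 1 by ring, add_zero, pow_succ x (i + 1 + r),
      show (∫ u in (0 : ℝ)..x, f u) = F x from rfl]
    field_simp
    ring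

/-- Let `A k` be the distribution functions obtained from `F ^ m` by successive convolution with
the densities of `X / (m + 1), …, X / n`. If `A n = F ^ n`, then `f` cannot deviate from
`lam * exp (κ y)` at an order `r ≥ 2`: the error terms all have the sign of the deviation and are
propagated with that sign, as convolution with `f ≥ 0` is monotone. -/
theorem eq_zero_of_iterated_scaledConv_eq_pow {f : ℝ → ℝ} (hf : ContinuousOn f (Ici 0))
    (hf0 : ∀ x, 0 ≤ f x) {lam κ c : ℝ} {r m n : ℕ} (hm : 1 ≤ m) (hmn : m < n)
    (hlam : 0 < lam) (hr : 2 ≤ r)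
    (hc : Tendsto (fun x => (f x - lam * Real.exp (κ * x)) / x ^ r) (𝓝[>] 0) (𝓝 c))
    (A : ℕ → ℝ → ℝ) (hmono : ∀ k, Monotone (A k))
    (hAm : ∀ x, 0 ≤ x → A m x = (∫ u in (0 : ℝ)..x, f u) ^ m)
    (hstep : ∀ k, m ≤ k → k < n → ∀ x, 0 ≤ x → A (k + 1) x = scaledConv f (k + 1) (A k) x)
    (hAn : ∀ x, 0 ≤ x → A n x = (∫ u in (0 : ℝ)..x, f u) ^ n) : c = 0 := by
  by_contra hc0
  set F : ℝ → ℝ := fun x => ∫ u in (0 : ℝ)..x, f u with hF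
  have hFc : ContinuousOn F (Ici 0) := continuousOn_integral_Ici hf
  have hdefect : ∀ k, m ≤ k → ∀ᶠ x in 𝓝[>] (0 : ℝ),
      0 < c * (scaledConv f (k + 1) (fun y => F y ^ k) x - F x ^ (k + 1)) := by
    intro k hk
    obtain ⟨i, rfl⟩ : ∃ i, k = i + 1 := ⟨k - 1, by omega⟩
    obtain ⟨C, hC, ht⟩ := exists_tendsto_scaledConv_sub_pow hf hlam hr hc i
    have hpos : 0 < c * (C * c) := by
      have : 0 < c * c := mul_self_pos.2 hc0
      nlinarith
    filter_upwards [(ht.const_mul c).eventually_const_lt hpos, self_mem_nhdsWithin] with x h1 h2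
    have h2 : 0 < x := h2
    rw [← mul_div_assoc, lt_div_iff₀ (by positivity), zero_mul] at h1
    exact h1
  -- `A (k + 1) - F ^ (k + 1)` is the convolution of `A k - F ^ k` with a non-negative density plus
  -- the defect of the step, and both have the sign of `c`.
  have key : ∀ k, m ≤ k → k ≤ n → ∃ ε > 0, ∀ x, 0 ≤ x → x < ε →
      0 ≤ c * (A k x - F x ^ k) ∧ (m < k → 0 < x → 0 < c * (A k x - F x ^ k)) := by
    intro k hk
    induction k, hk using Nat.le_induction with
    | base =>
      intro _
      exact ⟨1, one_pos, fun x hx _ => by simp [hAm x hx, hF]⟩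
    | succ k hk ih =>
      intro hkn
      obtain ⟨ε, hε, H⟩ := ih (by omega)
      obtain ⟨δ, hδ, hδ'⟩ := (mem_nhdsGT_iff_exists_Ioo_subset).1 (hdefect k hk)
      have hδ : 0 < δ := hδ
      refine ⟨min ε δ, lt_min hε hδ, fun x hx hxε => ?_⟩
      have hzero : A (k + 1) 0 - F 0 ^ (k + 1) = 0 := by
        rw [hstep k hk (by omega) 0 le_rfl]
        simp [scaledConv, hF]
      have hstrict : 0 < x → 0 < c * (A (k + 1) x - F x ^ (k + 1)) := by
        intro hx0
        have hkx : (0 : ℝ) ≤ (k + 1) * x := by positivity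
        have hFp : ContinuousOn (fun y => F y ^ k) (Ici 0) := hFc.pow _
        have c1 := continuousOn_comp_mul_one_sub hFp hx
        have c3 := continuousOn_comp_mul hf hkx
        have iA : IntervalIntegrable (fun t => A k (x * (1 - t)) * f ((k + 1) * x * t))
            volume 0 1 := by
          refine IntervalIntegrable.mul_continuousOn (AntitoneOn.intervalIntegrable ?_) c3
          intro s _ t _ hst
          exact hmono k (mul_le_mul_of_nonneg_left (by linarith) hx)
        have hsplit : c * (A (k + 1) x - F x ^ (k + 1)) =
            (k + 1) * x * (∫ t in (0 : ℝ)..1,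
              c * (A k (x * (1 - t)) - F (x * (1 - t)) ^ k) * f ((k + 1) * x * t)) +
            c * (scaledConv f (k + 1) (fun y => F y ^ k) x - F x ^ (k + 1)) := by
          have iF : IntervalIntegrable (fun t => F (x * (1 - t)) ^ k * f ((k + 1) * x * t))
              volume 0 1 := (c1.mul c3).intervalIntegrable
          have e : ∀ t, c * (A k (x * (1 - t)) - F (x * (1 - t)) ^ k) * f ((k + 1) * x * t) =
              c * (A k (x * (1 - t)) * f ((k + 1) * x * t) -
                F (x * (1 - t)) ^ k * f ((k + 1) * x * t)) := fun t => by ring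
          simp only [e]
          rw [intervalIntegral.integral_const_mul, intervalIntegral.integral_sub iA iF,
            hstep k hk (by omega) x hx]
          unfold scaledConv
          ring
        rw [hsplit]
        refine add_pos_of_nonneg_of_pos (mul_nonneg hkx ?_)
          (hδ' ⟨hx0, hxε.trans_le (min_le_right _ _)⟩)
        refine intervalIntegral.integral_nonneg zero_le_one fun t ht => ?_
        refine mul_nonneg (H _ (mul_nonneg hx (by linarith [ht.2])) ?_).1 (hf0 _)
        have := hxε.trans_le (min_le_left _ _)
        nlinarith [ht.1]
      refine ⟨?_, fun _ => hstrict⟩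
      rcases hx.eq_or_lt with rfl | hx0
      · rw [hzero, mul_zero]
      · exact (hstrict hx0).le
  obtain ⟨ε, hε, H⟩ := key n hmn.le le_rfl
  have := (H (ε / 2) (by positivity) (by linarith)).2 hmn (by positivity)
  rw [hAn _ (by positivity)] at this
  simp [hF] at this

/-! ### Distribution functions and convolution -/

section Distribution

variable {Ω : Type*} [MeasurableSpace Ω] {P : Measure Ω} {f : ℝ → ℝ}

theorem ae_density_eq_zero_of_ae_nonneg {W : Ω → ℝ} (hf : Measurable f) (hf0 : ∀ x, 0 ≤ f x)
    (hW : HasLaw W (volume.withDensity fun x => ENNReal.ofReal (f x)) P)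
    (hpos : ∀ᵐ ω ∂P, 0 ≤ W ω) : ∀ᵐ w : ℝ, w < 0 → f w = 0 := by
  have h1 : (volume.withDensity fun x => ENNReal.ofReal (f x)) (Iio 0) = 0 := by
    have h2 := hW.measure_eq (p := fun x => x < 0) measurableSet_Iio
    rw [show Iio (0 : ℝ) = {x | x < 0} from rfl, ← h2]
    simpa [ae_iff] using hpos
  rw [withDensity_apply _ measurableSet_Iio,
    lintegral_eq_zero_iff hf.ennreal_ofReal] at h1
  have h3 := (ae_restrict_iff' measurableSet_Iio).1 h1
  filter_upwards [h3] with w hw hw0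
  exact le_antisymm (by simpa using hw hw0) (hf0 w)

/-- Adding an independent `W / k`, where `W ≥ 0` has density `f`, acts on distribution functions of
non-negative variables as `scaledConv f k`. -/
theorem measureReal_add_mul_le [IsProbabilityMeasure P] {Z W : Ω → ℝ} (hfm : Measurable f)
    (hf0 : ∀ x, 0 ≤ f x)
    (hfneg : ∀ᵐ w : ℝ, w < 0 → f w = 0) (hfc : ContinuousOn f (Ici 0))
    (hW : HasLaw W (volume.withDensity fun x => ENNReal.ofReal (f x)) P)
    (hZ : AEMeasurable Z P) (hZ0 : ∀ᵐ ω ∂P, 0 ≤ Z ω) (hZW : IndepFun Z W P) {k : ℝ} (hk : 0 < k)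
    {x : ℝ} (hx : 0 ≤ x) :
    P.real {ω | Z ω + 1 / k * W ω ≤ x} = scaledConv f k (fun y => P.real {ω | Z ω ≤ y}) x := by
  have := Measure.isProbabilityMeasure_map (μ := P) hZ
  have hWp := Measure.isProbabilityMeasure_map (μ := P) hW.aemeasurable
  set μ := P.map Z with hμ
  have hAμ : ∀ y, P.real {ω | Z ω ≤ y} = μ.real (Iic y) := by
    intro y
    rw [hμ, map_measureReal_apply_of_aemeasurable hZ measurableSet_Iic]
    rfl
  simp only [hAμ]
  have hneg : ∀ y, y < 0 → μ (Iic y) = 0 := by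
    intro y hy
    rw [hμ, Measure.map_apply_of_aemeasurable hZ measurableSet_Iic]
    refine measure_mono_null (fun ω hω => ?_) (ae_iff.1 hZ0)
    have : Z ω ≤ y := hω
    simp only [mem_ofPred_eq, not_le]
    linarith
  have hanti : Antitone fun w : ℝ => μ.real (Iic (x - w / k)) := fun a b hab =>
    measureReal_mono (Iic_subset_Iic.2 (by gcongr))
  have hkx : 0 ≤ k * x := mul_nonneg hk.le hx
  have hS : MeasurableSet {p : ℝ × ℝ | p.1 + 1 / k * p.2 ≤ x} :=
    measurableSet_le (by fun_prop) (by fun_prop)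
  have h1 : P {ω | Z ω + 1 / k * W ω ≤ x} = ∫⁻ w in Ioc 0 (k * x),
      ENNReal.ofReal (μ.real (Iic (x - w / k)) * f w) := by
    have h2 : P {ω | Z ω + 1 / k * W ω ≤ x} =
        P.map (fun ω => (Z ω, W ω)) {p : ℝ × ℝ | p.1 + 1 / k * p.2 ≤ x} := by
      rw [Measure.map_apply_of_aemeasurable (hZ.prodMk hW.aemeasurable) hS]
      rfl
    rw [h2, (indepFun_iff_map_prod_eq_prod_map_map hZ hW.aemeasurable).1 hZW,
      Measure.prod_apply_symm hS, hW.map_eq]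
    have h3 : ∀ w, (fun z : ℝ => (z, w)) ⁻¹' {p : ℝ × ℝ | p.1 + 1 / k * p.2 ≤ x} =
        Iic (x - w / k) := by
      intro w
      ext z
      simp only [mem_preimage, mem_ofPred_eq, mem_Iic]
      rw [le_sub_iff_add_le, one_div_mul_eq_div]
    simp only [← hμ, h3]
    have hmeas : Measurable fun w : ℝ => μ (Iic (x - w / k)) :=
      Antitone.measurable fun a b hab => measure_mono (Iic_subset_Iic.2 (by gcongr))
    rw [lintegral_withDensity_eq_lintegral_mul _ hfm.ennreal_ofReal hmeas,
      ← lintegral_indicator measurableSet_Ioc]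
    refine lintegral_congr_ae ?_
    have hne : ∀ᵐ w : ℝ, w ≠ 0 := by simp [ae_iff]
    filter_upwards [hfneg, hne] with w hw hw0
    by_cases hmem : w ∈ Ioc 0 (k * x)
    · rw [indicator_of_mem hmem, ENNReal.ofReal_mul measureReal_nonneg, ofReal_measureReal, mul_comm]
      rfl
    · rw [indicator_of_notMem hmem]
      simp only [Pi.mul_apply]
      rcases lt_or_gt_of_ne hw0 with h | h
      · simp [hw h]
      · rw [hneg _ _, mul_zero]
        have : k * x < w := by
          by_contra hcon
          exact hmem ⟨h, not_lt.1 hcon⟩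
        rwa [sub_neg, lt_div_iff₀' hk]
  have hint : IntervalIntegrable (fun w => μ.real (Iic (x - w / k)) * f w) volume 0 (k * x) := by
    refine IntervalIntegrable.mul_continuousOn hanti.intervalIntegrable (hfc.mono ?_)
    rw [uIcc_of_le hkx]
    exact Icc_subset_Ici_self
  rw [measureReal_def, h1, ← ofReal_integral_eq_lintegral_ofReal
    ((intervalIntegrable_iff_integrableOn_Ioc_of_le hkx).1 hint)
    (ae_of_all _ fun w => mul_nonneg measureReal_nonneg (hf0 w)),
    ENNReal.toReal_ofReal (integral_nonneg fun w => mul_nonneg measureReal_nonneg (hf0 w)),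
    ← intervalIntegral.integral_of_le hkx]
  have hsub := intervalIntegral.mul_integral_comp_mul_left (a := 0) (b := 1)
    (f := fun w => μ.real (Iic (x - w / k)) * f w) (k * x)
  rw [mul_zero, mul_one] at hsub
  rw [← hsub, scaledConv]
  congr 2 with t
  have : x - k * x * t / k = x * (1 - t) := by field_simp
  rw [this]

theorem measureReal_le_eq_integral {W : Ω → ℝ} (hf0 : ∀ x, 0 ≤ f x)
    (hfneg : ∀ᵐ w : ℝ, w < 0 → f w = 0) (hfc : ContinuousOn f (Ici 0))
    (hW : HasLaw W (volume.withDensity fun x => ENNReal.ofReal (f x)) P) {x : ℝ} (hx : 0 ≤ x) :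
    P.real {ω | W ω ≤ x} = ∫ u in (0 : ℝ)..x, f u := by
  have h1 : P {ω | W ω ≤ x} = ∫⁻ w in Ioc 0 x, ENNReal.ofReal (f w) := by
    rw [hW.measure_eq (p := fun w => w ≤ x) measurableSet_Iic,
      show {w | w ≤ x} = Iic x from rfl, withDensity_apply _ measurableSet_Iic,
      ← lintegral_indicator measurableSet_Iic,
      ← lintegral_indicator measurableSet_Ioc]
    refine lintegral_congr_ae ?_
    have hne : ∀ᵐ w : ℝ, w ≠ 0 := by simp [ae_iff]
    filter_upwards [hfneg, hne] with w hw hw0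
    rcases lt_or_gt_of_ne hw0 with h | h
    · simp [indicator, hw h]
    · simp [indicator, h]
  have hint : IntegrableOn f (Ioc 0 x) :=
    ((hfc.mono Icc_subset_Ici_self).integrableOn_Icc).mono_set Ioc_subset_Icc_self
  rw [measureReal_def, h1, ← ofReal_integral_eq_lintegral_ofReal hint
    (ae_of_all _ fun w => hf0 w), ENNReal.toReal_ofReal (integral_nonneg fun w => hf0 w),
    ← intervalIntegral.integral_of_le hx]

end Distribution

/-! ### Weighted sums with a maximum of independent variables -/

theorem maxOrderStat_le_iff {Ω : Type*} (Y : ℕ → Ω → ℝ) {m : ℕ} (hm : 1 ≤ m) (ω : Ω) (x : ℝ) :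
    maxOrderStat Y m ω ≤ x ↔ ∀ i : Finset.Icc 1 m, Y i ω ≤ x := by
  have : Nonempty (Finset.Icc 1 m) := ⟨⟨1, by simp [hm]⟩⟩
  exact ciSup_le_iff (Set.finite_range _).bddAbove

theorem measurable_maxOrderStat {α : Type*} [MeasurableSpace α] {Y : ℕ → α → ℝ}
    (hY : ∀ i, Measurable (Y i)) (m : ℕ) : Measurable (maxOrderStat Y m) :=
  Measurable.iSup fun i : Finset.Icc 1 m => hY i

/-- The variable `max (Y 1, …, Y m) + Y (m + 1) / (m + 1) + ⋯ + Y k / k`. It is built up from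
`k = m`, where the sum is empty. -/
noncomputable def weightedMax {Ω : Type*} (Y : ℕ → Ω → ℝ) (m k : ℕ) (ω : Ω) : ℝ :=
  maxOrderStat Y m ω + ∑ i ∈ Finset.Icc (m + 1) k, (1 / (i : ℝ)) * Y i ω

theorem weightedMax_self {Ω : Type*} (Y : ℕ → Ω → ℝ) (m : ℕ) :
    weightedMax Y m m = maxOrderStat Y m := by
  ext ω
  simp [weightedMax]

theorem weightedMax_succ {Ω : Type*} (Y : ℕ → Ω → ℝ) {m k : ℕ} (hmk : m ≤ k) (ω : Ω) :
    weightedMax Y m (k + 1) ω = weightedMax Y m k ω + 1 / ((k : ℝ) + 1) * Y (k + 1) ω := by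
  simp only [weightedMax]
  rw [Finset.sum_Icc_succ_top (by omega), add_assoc]
  push_cast
  rfl

/-- Only the first `k` variables enter `weightedMax Y m k`, which makes it independent of the later
ones. -/
theorem exists_measurable_weightedMax_eq {Ω : Type*} {Y : ℕ → Ω → ℝ} {n m k : ℕ}
    (hmk : m ≤ k) (hkn : k ≤ n) :
    ∃ φ : ((Finset.univ.filter fun i : Finset.Icc 1 n => (i : ℕ) ≤ k) → ℝ) → ℝ, Measurable φ ∧
      ∀ ω, weightedMax Y m k ω = φ fun i => Y i ω := by
  classical
  let S := Finset.univ.filter fun i : Finset.Icc 1 n => (i : ℕ) ≤ k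
  have hS : ∀ i, i ∈ Finset.Icc 1 k → ∃ h : i ∈ Finset.Icc 1 n, (⟨i, h⟩ : Finset.Icc 1 n) ∈ S := by
    intro i hi
    exact ⟨Finset.Icc_subset_Icc_right hkn hi, by simpa [S] using (Finset.mem_Icc.1 hi).2⟩
  -- Extend a vector indexed by `S` by zero to a sequence.
  let e : ℕ → (S → ℝ) → ℝ := fun i v =>
    if h : i ∈ Finset.Icc 1 k then v ⟨⟨i, (hS i h).1⟩, (hS i h).2⟩ else 0
  have he : ∀ i, Measurable (e i) := by
    intro i
    by_cases h : i ∈ Finset.Icc 1 k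
    · simp only [e, dif_pos h]
      exact measurable_pi_apply _
    · simp only [e, dif_neg h]
      exact measurable_const
  refine ⟨weightedMax e m k, (measurable_maxOrderStat he m).add
    (Finset.measurable_sum _ fun i _ => (he i).const_mul _), fun ω => ?_⟩
  have hval : ∀ i ∈ Finset.Icc 1 k, e i (fun i : S => Y i ω) = Y i ω := by
    intro i hi
    simp only [e, dif_pos hi]
  unfold weightedMax maxOrderStat
  congr 1
  · exact iSup_congr fun i => (hval i (Finset.Icc_subset_Icc_right hmk i.2)).symm
  · refine Finset.sum_congr rfl fun i hi => ?_
    rw [hval i (Finset.Icc_subset_Icc_left (by omega) hi)]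

section WeightedMax

variable {Ω : Type*} [MeasurableSpace Ω] {P : Measure Ω} {Y : ℕ → Ω → ℝ} {n : ℕ}

theorem measure_maxOrderStat_le [IsProbabilityMeasure P] {m : ℕ} (hm : 1 ≤ m) (hmn : m ≤ n)
    (hY : iIndepFun (fun i : Finset.Icc 1 n => Y i) P) {x p : ℝ}
    (hp : ∀ i ∈ Finset.Icc 1 n, P.real {ω | Y i ω ≤ x} = p) :
    P.real {ω | maxOrderStat Y m ω ≤ x} = p ^ m := by
  have hmem : ∀ i : Finset.Icc 1 m, (i : ℕ) ∈ Finset.Icc 1 n := fun i =>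
    Finset.Icc_subset_Icc_right hmn i.2
  let g : Finset.Icc 1 m → Finset.Icc 1 n := fun i => ⟨i, hmem i⟩
  have hg : Function.Injective g := fun i j hij => by
    have := congrArg (fun z : Finset.Icc 1 n => (z : ℕ)) hij
    exact Subtype.ext this
  have h1 : {ω | maxOrderStat Y m ω ≤ x} = ⋂ i : Finset.Icc 1 m, {ω | Y i ω ≤ x} := by
    ext ω
    simp only [mem_ofPred_eq, mem_iInter]
    exact maxOrderStat_le_iff Y hm ω x
  have hind : iIndepFun (fun i : Finset.Icc 1 m => Y i) P := hY.precomp (g := g) hg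
  have h2 := hind.meas_iInter (s := fun i : Finset.Icc 1 m => {ω | Y i ω ≤ x})
    fun i => ⟨Iic x, measurableSet_Iic, rfl⟩
  rw [h1, measureReal_def, h2, ENNReal.toReal_prod]
  have h3 : ∀ i : Finset.Icc 1 m, (P {ω | Y i ω ≤ x}).toReal = p := fun i => hp i (hmem i)
  simp [h3]

theorem aemeasurable_weightedMax (hYm : ∀ i ∈ Finset.Icc 1 n, AEMeasurable (Y i) P) {m k : ℕ}
    (hmk : m ≤ k) (hkn : k ≤ n) : AEMeasurable (weightedMax Y m k) P := by
  obtain ⟨φ, hφ, h⟩ := exists_measurable_weightedMax_eq (Y := Y) hmk hkn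
  rw [funext h]
  exact hφ.comp_aemeasurable (aemeasurable_pi_lambda _ fun i => hYm _ i.1.2)

theorem indepFun_weightedMax (hYm : ∀ i ∈ Finset.Icc 1 n, AEMeasurable (Y i) P)
    (hY : iIndepFun (fun i : Finset.Icc 1 n => Y i) P) {m k : ℕ}
    (hmk : m ≤ k) (hkn : k < n) : IndepFun (weightedMax Y m k) (Y (k + 1)) P := by
  obtain ⟨φ, hφ, h⟩ := exists_measurable_weightedMax_eq (Y := Y) hmk hkn.le
  let j : Finset.Icc 1 n := ⟨k + 1, Finset.mem_Icc.2 ⟨by omega, hkn⟩⟩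
  have hdisj : Disjoint (Finset.univ.filter fun i : Finset.Icc 1 n => (i : ℕ) ≤ k) {j} := by
    simp [j]
  have := (hY.indepFun_finset₀ _ {j} hdisj fun i => hYm _ i.2).comp hφ
    (measurable_pi_apply (⟨j, by simp⟩ : ({j} : Finset (Finset.Icc 1 n))))
  rw [funext h]
  exact this

theorem weightedMax_nonneg_ae (hYpos : ∀ i ∈ Finset.Icc 1 n, ∀ᵐ ω ∂P, 0 ≤ Y i ω) {m k : ℕ}
    (hm : 1 ≤ m) (hmk : m ≤ k) (hkn : k ≤ n) : ∀ᵐ ω ∂P, 0 ≤ weightedMax Y m k ω := by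
  have hall : ∀ᵐ ω ∂P, ∀ i ∈ Finset.Icc 1 n, 0 ≤ Y i ω :=
    (Finset.eventually_all (Finset.Icc 1 n)).2 hYpos
  filter_upwards [hall] with ω hω
  refine add_nonneg ?_ (Finset.sum_nonneg fun i hi => mul_nonneg (by positivity) (hω i ?_))
  · exact (hω 1 (Finset.mem_Icc.2 ⟨le_rfl, by omega⟩)).trans
      ((maxOrderStat_isGreatest Y hm ω).2 ⟨1, ⟨le_rfl, hm⟩, rfl⟩)
  · rw [Finset.mem_Icc] at hi ⊢
    omega

end WeightedMax

/-! ### Identification of the density -/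

/-- An analytic density with `f 0 > 0` is `f 0 * exp (κ x)` as soon as it does not deviate from the
exponential function with the same value and slope at the origin at any order `r ≥ 2`. -/
theorem exists_eq_mul_exp_of_analyticOn {f : ℝ → ℝ} (hf : AnalyticOn ℝ f (Ici 0)) (hf0 : 0 < f 0)
    (H : ∀ (κ c : ℝ) (r : ℕ), 2 ≤ r →
      Tendsto (fun x => (f x - f 0 * Real.exp (κ * x)) / x ^ r) (𝓝[>] 0) (𝓝 c) → c = 0) :
    ∃ κ : ℝ, ∀ x, 0 < x → f x = f 0 * Real.exp (κ * x) := by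
  obtain ⟨g, hfg0, hfg, hg⟩ := (hf 0 self_mem_Ici).exists_analyticAt
  have hfg' : ∀ x, 0 ≤ x → f x = g x := fun x hx => hfg (mem_insert_of_mem _ hx)
  set κ := deriv g 0 / f 0 with hκ
  refine ⟨κ, ?_⟩
  have hE : ∀ x, AnalyticAt ℝ (fun x => f 0 * Real.exp (κ * x)) x := fun x =>
    analyticAt_const.mul (analyticAt_const.mul analyticAt_id).rexp
  have hEd : HasDerivAt (fun x => f 0 * Real.exp (κ * x)) (f 0 * κ) 0 := by
    have := (((hasDerivAt_id (0 : ℝ)).const_mul κ).exp).const_mul (f 0)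
    simpa using this
  have hd : HasDerivAt (fun x => g x - f 0 * Real.exp (κ * x)) 0 0 := by
    have := hg.differentiableAt.hasDerivAt.sub hEd
    rwa [hκ, mul_div_cancel₀ _ hf0.ne', sub_self] at this
  have hzero : ∀ᶠ z in 𝓝 (0 : ℝ), g z - f 0 * Real.exp (κ * z) = 0 := by
    by_contra hcon
    obtain ⟨r, h, hh, hh0, heq⟩ := (hg.sub (hE 0)).exists_eventuallyEq_pow_smul_nonzero_iff.2 hcon
    simp only [sub_zero, smul_eq_mul] at heq
    have hr : 2 ≤ r := by
      by_contra hr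
      -- Orders `0` and `1` are excluded by the equality of the values and of the slopes.
      obtain rfl | rfl : r = 0 ∨ r = 1 := by omega
      · have := heq.self_of_nhds
        rw [Pi.sub_apply, ← hfg0] at this
        simp at this
        exact hh0 this.symm
      · have h1 : HasDerivAt (fun z => z ^ 1 * h z) (h 0) 0 := by
          have := (hasDerivAt_id (0 : ℝ)).mul hh.differentiableAt.hasDerivAt
          simp only [pow_one]
          convert! this using 1
          simp
        exact hh0 ((h1.congr_of_eventuallyEq heq).unique hd)
    refine hh0 (H κ (h 0) r hr ?_)
    refine ((hh.continuousAt.tendsto).mono_left nhdsWithin_le_nhds).congr' ?_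
    filter_upwards [heq.filter_mono nhdsWithin_le_nhds, self_mem_nhdsWithin] with x hx hx0
    have hx0 : 0 < x := hx0
    rw [hfg' x hx0.le, eq_div_iff (by positivity), mul_comm, ← hx]
    rfl
  obtain ⟨ε, hε, hball⟩ := Metric.eventually_nhds_iff.1 hzero
  have hf' : AnalyticOnNhd ℝ f (Ioi 0) :=
    isOpen_Ioi.analyticOn_iff_analyticOnNhd.1 (hf.mono Ioi_subset_Ici_self)
  have hnear : f =ᶠ[𝓝 (ε / 2)] fun x => f 0 * Real.exp (κ * x) := by
    filter_upwards [Ioo_mem_nhds (half_pos hε) (half_lt_self hε)] with x hx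
    rw [hfg' x hx.1.le]
    refine sub_eq_zero.1 (hball ?_)
    rw [Real.dist_eq, sub_zero, abs_of_pos hx.1]
    exact hx.2
  exact fun x hx => hf'.eqOn_of_preconnected_of_eventuallyEq (fun x _ => hE x)
    isPreconnected_Ioi (mem_Ioi.2 (half_pos hε)) hnear hx

/-- A probability density on `[0, ∞)` of the form `lam * exp (κ x)` is an exponential density:
integrability makes `κ` negative, and total mass one gives `lam = -κ`. -/
theorem withDensity_eq_expMeasure {f : ℝ → ℝ} {lam κ : ℝ} (hlam : 0 < lam)
    (hneg : ∀ᵐ w : ℝ, w < 0 → f w = 0) (hpos : ∀ x, 0 < x → f x = lam * Real.exp (κ * x))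
    (hmass : ∫⁻ x, ENNReal.ofReal (f x) = 1) :
    0 < -κ ∧ volume.withDensity (fun x => ENNReal.ofReal (f x)) = expMeasure (-κ) := by
  have hκ : 0 < -κ := by
    by_contra hcon
    have hκ : 0 ≤ κ := by linarith
    have h1 : ∫⁻ _ in Ioi (0 : ℝ), ENNReal.ofReal lam ≤ 1 := by
      rw [← hmass]
      refine le_trans (setLIntegral_mono' measurableSet_Ioi fun x hx => ?_)
        (setLIntegral_le_lintegral (Ioi 0) _)
      have hx : 0 < x := hx
      rw [hpos x hx]
      exact ENNReal.ofReal_le_ofReal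
        (le_mul_of_one_le_right hlam.le (Real.one_le_exp (mul_nonneg hκ hx.le)))
    rw [setLIntegral_const, Real.volume_Ioi, ENNReal.mul_top (by simpa using hlam)] at h1
    exact absurd h1 (by simp)
  refine ⟨hκ, ?_⟩
  have hpdf : ∀ᵐ x : ℝ, ENNReal.ofReal (f x) =
      ENNReal.ofReal (lam / -κ) * exponentialPDF (-κ) x := by
    have hne : ∀ᵐ w : ℝ, w ≠ 0 := by simp [ae_iff]
    filter_upwards [hneg, hne] with x hx hx0
    rcases lt_or_gt_of_ne hx0 with h | h
    · rw [hx h, exponentialPDF_of_neg h, ENNReal.ofReal_zero, mul_zero]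
    · rw [hpos x h, exponentialPDF_of_nonneg h.le, ← ENNReal.ofReal_mul (by positivity),
        ← mul_assoc, div_mul_cancel₀ _ hκ.ne', neg_mul, neg_neg]
  have hone : ENNReal.ofReal (lam / -κ) = 1 := by
    rw [lintegral_congr_ae hpdf, lintegral_const_mul' _ _ ENNReal.ofReal_ne_top,
      lintegral_exponentialPDF_eq_one hκ, mul_one] at hmass
    exact hmass
  rw [hone] at hpdf
  simp only [one_mul] at hpdf
  rw [withDensity_congr_ae hpdf]
  rfl

theorem mainTheorem1 {Ω Ω' : Type*} [MeasurableSpace Ω] [MeasurableSpace Ω']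
    (P : Measure Ω) [IsProbabilityMeasure P] (P' : Measure Ω') [IsProbabilityMeasure P']
    -- the parent variable `X`, non-negative, with probability density function `f`
    (X : Ω → ℝ) (hX_nonneg : ∀ᵐ ω ∂P, 0 ≤ X ω)
    (f : ℝ → ℝ) (hf_meas : Measurable f) (hf_nonneg : ∀ x, 0 ≤ f x)
    (hf_pdf : HasLaw X (volume.withDensity (fun x => ENNReal.ofReal (f x))) P)
    -- `f` is analytic at every point of `[0, ∞)` and positive at the origin
    (hf_analytic : AnalyticOn ℝ f (Set.Ici 0)) (hf_zero : 0 < f 0)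
    (n s : ℕ) (hs : 1 ≤ s) (hsn : s ≤ n - 1)
    -- `Y 1, …, Y n` are independent copies of `X`
    (Y : ℕ → Ω' → ℝ) (hY_indep : iIndepFun (fun i : Finset.Icc 1 n => Y i) P')
    (hY_copy : ∀ i ∈ Finset.Icc 1 n, IdentDistrib (Y i) X P' P)
    (h : IdentDistrib
      (fun ω => maxOrderStat Y (n - s) ω + ∑ i ∈ Finset.Icc (n - s + 1) n, (1 / (i : ℝ)) * Y i ω)
      (fun ω => maxOrderStat Y n ω) P' P') :
    ∃ r : ℝ, 0 < r ∧ HasLaw X (expMeasure r) P := by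
  have hcont : ContinuousOn f (Ici 0) := hf_analytic.continuousOn
  have hneg := ae_density_eq_zero_of_ae_nonneg hf_meas hf_nonneg hf_pdf hX_nonneg
  have hYlaw : ∀ i ∈ Finset.Icc 1 n,
      HasLaw (Y i) (volume.withDensity fun x => ENNReal.ofReal (f x)) P' := fun i hi =>
    ⟨(hY_copy i hi).aemeasurable_fst, (hY_copy i hi).map_eq.trans hf_pdf.map_eq⟩
  have hYm : ∀ i ∈ Finset.Icc 1 n, AEMeasurable (Y i) P' := fun i hi => (hYlaw i hi).aemeasurable
  have hYpos : ∀ i ∈ Finset.Icc 1 n, ∀ᵐ ω ∂P', 0 ≤ Y i ω := fun i hi =>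
    (hY_copy i hi).symm.ae_snd measurableSet_Ici hX_nonneg
  set m := n - s with hm
  have hm1 : 1 ≤ m := by omega
  have hmn : m < n := by omega
  have hmax : ∀ k, 1 ≤ k → k ≤ n → ∀ x, 0 ≤ x →
      P'.real {ω | maxOrderStat Y k ω ≤ x} = (∫ u in (0 : ℝ)..x, f u) ^ k :=
    fun k hk1 hkn x hx => measure_maxOrderStat_le hk1 hkn hY_indep fun i hi =>
      measureReal_le_eq_integral hf_nonneg hneg hcont (hYlaw i hi) hx
  obtain ⟨κ, hκ⟩ := exists_eq_mul_exp_of_analyticOn hf_analytic hf_zero fun κ c r hr hc =>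
    eq_zero_of_iterated_scaledConv_eq_pow hcont hf_nonneg hm1 hmn hf_zero hr hc
      (fun k x => P'.real {ω | weightedMax Y m k ω ≤ x})
      (fun k a b hab => measureReal_mono fun ω hω => le_trans hω hab)
      (fun x hx => by
        simp only [weightedMax_self]
        exact hmax m hm1 hmn.le x hx)
      (fun k hmk hkn x hx => by
        simp only [weightedMax_succ Y hmk]
        exact measureReal_add_mul_le hf_meas hf_nonneg hneg hcont
          (hYlaw (k + 1) (Finset.mem_Icc.2 ⟨by omega, hkn⟩))
          (aemeasurable_weightedMax hYm hmk hkn.le) (weightedMax_nonneg_ae hYpos hm1 hmk hkn.le)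
          (indepFun_weightedMax hYm hY_indep hmk hkn) (by positivity) hx)
      (fun x hx => by
        rw [← hmax n (by omega) le_rfl x hx]
        exact congrArg ENNReal.toReal (h.measure_mem_eq measurableSet_Iic))
  have hmass : ∫⁻ x, ENNReal.ofReal (f x) = 1 := by
    rw [← setLIntegral_univ, ← withDensity_apply _ MeasurableSet.univ, ← hf_pdf.map_eq,
      Measure.map_apply_of_aemeasurable hf_pdf.aemeasurable MeasurableSet.univ, preimage_univ,
      measure_univ]
  obtain ⟨hr, hlaw⟩ := withDensity_eq_expMeasure hf_zero hneg hκ hmass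
  exact ⟨-κ, hr, hf_pdf.aemeasurable, hf_pdf.map_eq.trans hlaw⟩
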